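/- An *idiom* is a complete lattice $A$ that is modular and upper-continuous ($a\wedge\bigvee X=\bigvee_{x\in X}(a\wedge x)$ for directed $X$). A *nucleus* on $A$ is an idempotent map $j\colon A\to A$ with $x\le j(x)$ and $j(x\wedge y)=j(x)\wedge j(y)$. The nuclei, ordered pointwise, form a frame $N(A)$ with top $tp$ (the constant map $1$), and $\neg j$ denotes the pseudocomplement of $j$ there. The nucleus $j$ is *spectral* if the lattice $A_j=\{a\in A: j(a)=a\}$ is complemented. For intervals $[a,b]$ ($a\le b$) of $A$: $\mathcal D_j=\{[a,b]: b\le j(a)\}$. The interval $[a,b]$ is *simple* if there is no $x$ with $a<x<b$. It is *semi-simple* if $b$ is the supremum in $[a,b]$ of some $X\subseteq[a,b]$ with $[a,x]$ simple for all $x\in X$. It is *weakly atomic* if for all $a\le c<d\le b$ there are $c\le x<y\le d$ with $[x,y]$ simple. Let $\mathcal{WA}$ be the set of weakly atomic intervals. Two intervals are *similar* if they have the form $[l,l\vee r]$ and $[l\wedge r,r]$. A *division set* is a nonempty set $\mathcal D$ of intervals that is closed under similarity and subintervals, and such that $[a,b],[b,c]\in\mathcal D$ implies $[a,c]\in\mathcal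 D$, and $[a,x]\in\mathcal D$ for all $x\in X\ne\emptyset$ implies $[a,\bigvee X]\in\mathcal D$. The set $\mathcal{SA}$ of *semi-atomic* intervals is the least division set containing all semi-simple intervals. Let $soc(a)=\bigvee\{x\ge a:[a,x]\text{ simple}\}$, and let $soc^\infty$ be the value at which the ordinal iterates of $soc$ (composition at successors, pointwise suprema at limits) stabilize. For a nucleus $k$, let $Gab(k)(a)=\bigvee\{x\ge a:[a,x]\in\mathcal G\}$, where $\mathcal G$ is the least division set containing all intervals $[a,b]$ such that every $x\in[a,b]$ has $x=a$ or $[x,b]\in\mathcal D_k$. **Theorem.** (1) Let $j$ be a nucleus on an idiom $A$ such that $j$ and $\neg j$ are both spectral. Then $\mathcal D_{\neg j}\cap\mathcal{WA}\subseteq\mathcal{SA}$ and $\mathcal D_{\neg\neg j}\cap\mathcal{WA}\subseteq\mathcal{SA}$; moreover $\mathcal{WA}\subseteq\mathcal{SA}$. (2) If, in addition, $A$ is weakly atomic (every interval of $A$ is weakly atomic), then $A$ is semi-atomic: every interval of $A$ is semi-atomic, and $Gab(\mathrm{id})=soc^\infty=tp$. (3) Let $R$ be an associative ring with unit, let $\Lambda(R)$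 be the lattice of left ideals of $R$, and let $\Xi(R)$ be the frame of linear nuclei on $\Lambda(R)$, that is, of nuclei $j$ with $j(I:r)=(j(I):r)$ for all left ideals $I$ and all $r\in R$, where $(I:r)=\{s: sr\in I\}$. If $j\in\Xi(R)$ and its pseudocomplement $\neg j$ in $\Xi(R)$ are both spectral nuclei, then $R$ is left semiartinian: every nonzero left $R$-module has a simple submodule. -/

import Mathlib

universe u v w

/-- An idiom: a complete, modular, upper-continuous lattice. -/
class IsIdiom (A : Type u) [CompleteLattice A] : Prop extends IsModularLattice A where
  inf_sSup_of_directedOn : ∀ (a : A) (X : Set A), DirectedOn (· ≤ ·) X →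
    a ⊓ sSup X = ⨆ x ∈ X, a ⊓ x

namespace Idiom

/-! ### Nuclei, their quotients, negation -/

/-- The negation (pseudocomplement) of an element of a frame, such as the frame of all nuclei
on an idiom: the join of all elements that meet it trivially. -/
def neg {L : Type u} [CompleteLattice L] (j : L) : L := sSup {k | k ⊓ j = ⊥}

section Quotient
variable {A : Type u} [CompleteLattice A]

/-- The quotient `A_j`: the set of elements fixed by the nucleus `j`, with the order of `A`. -/
def FixedPts (j : Nucleus A) : Type u := {a : A // j a = a}

instance (j : Nucleus A) : PartialOrder (FixedPts j) :=
  inferInstanceAs (PartialOrder {a : A // j a = a})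

/-- The canonical surjection `j^* : A → A_j` and the inclusion form a Galois insertion. -/
def fixedGI (j : Nucleus A) :
    GaloisInsertion (fun a : A => (⟨j a, j.idempotent a⟩ : FixedPts j)) (fun x => x.1) where
  choice a _ := ⟨j a, j.idempotent a⟩
  gc a x := by
    constructor
    · intro h
      exact le_trans j.le_apply h
    · intro h
      have h1 : j a ≤ j x.1 := j.monotone h
      rw [x.2] at h1
      exact h1
  le_l_u x := (j.le_apply : x.1 ≤ j x.1)
  choice_eq _ _ := rfl

instance (j : Nucleus A) : CompleteLattice (FixedPts j) := (fixedGI j).liftCompleteLattice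

/-- A nucleus `j` is spectral if `A_j` is a complemented lattice. -/
def IsSpectral (j : Nucleus A) : Prop := ComplementedLattice (FixedPts j)

end Quotient

/-! ### Sets of intervals

`NonemptyInterval A` is the type of pairs `a ≤ b` in `A`; on it, `I ≤ J` means that `I` is a
subinterval of `J`. -/

section Intervals
variable {A : Type u} [CompleteLattice A]

/-- The interval `[a, b]`. -/
def itv (a b : A) (h : a ≤ b) : NonemptyInterval A := ⟨(a, b), h⟩

/-- Similarity of intervals: `{I, J} = {[l, l ∨ r], [l ∧ r, r]}` for some `l`, `r`. -/
def Similar (I J : NonemptyInterval A) : Prop :=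
  ∃ l r : A,
    (J = itv l (l ⊔ r) le_sup_left ∧ I = itv (l ⊓ r) r inf_le_right) ∨
    (J = itv (l ⊓ r) r inf_le_right ∧ I = itv l (l ⊔ r) le_sup_left)

/-- Abstract sets: nonempty and closed under similarity. -/
structure IsAbstractSet (B : Set (NonemptyInterval A)) : Prop where
  nonempty : B.Nonempty
  similar : ∀ I J, Similar I J → I ∈ B → J ∈ B

/-- Basic sets: abstract and closed under subintervals. -/
structure IsBasicSet (B : Set (NonemptyInterval A)) : Prop extends IsAbstractSet B where
  subinterval : ∀ I J, J ≤ I → I ∈ B → J ∈ B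

/-- Congruence sets: basic and closed under abutting intervals. -/
structure IsCongruenceSet (B : Set (NonemptyInterval A)) : Prop extends IsBasicSet B where
  abut : ∀ (a b c : A) (hab : a ≤ b) (hbc : b ≤ c),
    itv a b hab ∈ B → itv b c hbc ∈ B → itv a c (hab.trans hbc) ∈ B

/-- Pre-division sets: basic, and closed under suprema of intervals with a common bottom. -/
structure IsPreDivisionSet (B : Set (NonemptyInterval A)) : Prop extends IsBasicSet B where
  sup : ∀ (a : A) (X : Set A) (hX : X.Nonempty) (h : ∀ x ∈ X, a ≤ x),
    (∀ x (hx : x ∈ X), itv a x (h x hx) ∈ B) →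
      itv a (sSup X) ((h _ hX.some_mem).trans (le_sSup hX.some_mem)) ∈ B

/-- Division sets. -/
def IsDivisionSet (B : Set (NonemptyInterval A)) : Prop :=
  IsCongruenceSet B ∧ IsPreDivisionSet B

/-- The least division set that contains `B` (the intersection of all of them). -/
def Dvs (B : Set (NonemptyInterval A)) : Set (NonemptyInterval A) :=
  ⋂₀ {D | IsDivisionSet D ∧ B ⊆ D}

/-- The division set `D_j` of a nucleus: `[a, b] ∈ D_j` iff `b ≤ j a`. -/
def divisionSet (j : Nucleus A) : Set (NonemptyInterval A) := {I | I.snd ≤ j I.fst}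

/-- Simple intervals: there is no `a < x < b` (trivial intervals are included). -/
def Smp : Set (NonemptyInterval A) := {I | ¬ ∃ x, I.fst < x ∧ x < I.snd}

/-- Semi-simple intervals: `b` is the supremum in `[a, b]` of a set of elements `x` with
`[a, x]` simple. -/
def SSp : Set (NonemptyInterval A) :=
  {I | ∃ X : Set A, X ⊆ Set.Icc I.fst I.snd ∧
    (∀ x ∈ X, ∃ h : I.fst ≤ x, itv I.fst x h ∈ Smp) ∧ I.fst ⊔ sSup X = I.snd}

/-- Semi-atomic intervals: the least division set that contains all semi-simple intervals. -/
def SA : Set (NonemptyInterval A) := Dvs SSp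

/-- Weakly atomic intervals: every nontrivial subinterval contains a nontrivial simple
interval. -/
def WA : Set (NonemptyInterval A) :=
  {I | ∀ c d, I.fst ≤ c → c < d → d ≤ I.snd →
    ∃ (x y : A) (h : x < y), c ≤ x ∧ y ≤ d ∧ itv x y h.le ∈ Smp}

/-- The `B`-critical intervals: for all `a ≤ x ≤ b`, either `a = x` or `[x, b] ∈ B`. -/
def Crt (B : Set (NonemptyInterval A)) : Set (NonemptyInterval A) :=
  {I | ∀ x, I.fst ≤ x → ∀ h : x ≤ I.snd, I.fst = x ∨ itv x I.snd h ∈ B}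

/-- The inflator associated with a set of intervals: `a ↦ ⋁ {x | [a, x] ∈ B}`. -/
def assocInflator (B : Set (NonemptyInterval A)) (a : A) : A :=
  sSup {x | ∃ h : a ≤ x, itv a x h ∈ B}

/-- The Gabriel derivative of a nucleus `j`, as a function on `A`: the inflator associated with
the division set generated by the `D_j`-critical intervals. -/
def Gab (j : Nucleus A) : A → A := assocInflator (Dvs (Crt (divisionSet j)))

/-- The socle derivative. -/
def soc : A → A := assocInflator Smp

/-- The ordinal iterates of `d`: `d^0 = id`, `d^(α+1) = d ∘ d^α`, and pointwise suprema at
limits. -/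
noncomputable def iter (d : A → A) (α : Ordinal.{u}) : A → A :=
  Ordinal.limitRecOn (motive := fun _ => A → A) α id (fun _ f => d ∘ f)
    (fun o _ ih a => ⨆ β : Set.Iio o, ih β.1 β.2 a)

/-- `d^∞`: the iterate of `d` at the least ordinal from which on the iterates are constant. -/
noncomputable def iterInfty (d : A → A) : A → A :=
  iter d (sInf {γ : Ordinal.{u} | ∀ α, γ ≤ α → iter d α = iter d γ})

end Intervals

/-! ### Linear nuclei on the lattice of left ideals -/

section Rings
variable {R : Type u} [Ring R]

/-- The left ideal `(I : r) = {s | s * r ∈ I}`. -/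
def colon (I : Ideal R) (r : R) : Ideal R := Submodule.comap (LinearMap.toSpanSingleton R R r) I

/-- A nucleus on the lattice of left ideals is linear if `j (I : r) = (j I : r)`. -/
def IsLinearNucleus (j : Nucleus (Ideal R)) : Prop :=
  ∀ (I : Ideal R) (r : R), j (colon I r) = colon (j I) r

variable (R) in
/-- `Ξ(R)`: the linear nuclei on the lattice of left ideals of `R`, ordered pointwise. -/
def LinearNucleus : Type u := {j : Nucleus (Ideal R) // IsLinearNucleus j}

instance : PartialOrder (LinearNucleus R) :=
  inferInstanceAs (PartialOrder {j : Nucleus (Ideal R) // IsLinearNucleus j})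

theorem isLinearNucleus_sInf (S : Set (LinearNucleus R)) :
    IsLinearNucleus (sInf (Subtype.val '' S) : Nucleus (Ideal R)) := by
  intro I r
  ext x
  simp only [colon, Nucleus.sInf_apply, Submodule.mem_comap, Submodule.mem_iInf]
  refine forall₂_congr fun j hj => ?_
  obtain ⟨k, _, rfl⟩ := hj
  have h := k.2 I r
  unfold colon at h
  rw [h, Submodule.mem_comap]

instance : InfSet (LinearNucleus R) :=
  ⟨fun S => ⟨sInf (Subtype.val '' S), isLinearNucleus_sInf S⟩⟩

/-- Infima of linear nuclei are computed pointwise. -/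
instance : CompleteLattice (LinearNucleus R) :=
  completeLatticeOfInf _ fun S => by
    constructor
    · intro j hj
      exact sInf_le (a := j.1) (Set.mem_image_of_mem _ hj)
    · intro j hj
      refine le_sInf (a := j.1) ?_
      rintro _ ⟨k, hk, rfl⟩
      exact hj hk

variable (R) in
/-- A ring is left semiartinian if every nonzero left module has a simple submodule. -/
def IsLeftSemiartinian : Prop :=
  ∀ (M : Type v) [AddCommGroup M] [Module R M], Nontrivial M →
    ∃ N : Submodule R M, IsSimpleModule R N

end Rings

end Idiom

/-! Everything rests on `exists_covBy_of_mem_WA`: if `j`, `k` are spectral and `k x ⊓ j x ≤ x`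
always, each nontrivial weakly atomic `[c, b]` has an atom over `c`. If a covering `x ⋖ y` in `[c,
b]` survives in the quotient of a spectral nucleus for which `c` is closed relative to `b`, a
relative complement there projects it down to a covering of `c` (`IsSpectral.exists_covBy`). A
covering always survives for `j` or for `k`; and if `c` is not closed for one of them, some `[c, d]`
with `c < d ≤ b` is torsion for it, hence torsion-free for the other. Climbing along atoms then
gives semi-atomicity and `soc^∞ = tp`. Over a ring all intervals are weakly atomic by Zorn, so each
proper left ideal has a cover, and cyclic modules do the rest. -/

namespace Idiom

/-! ### Torsion-free intervals and the pseudocomplement of a nucleus -/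

section TorsionFree
variable {A : Type u} [CompleteLattice A]

/-- The interval `[a, b]` is torsion-free for the nucleus `j`: each of its elements is
`j`-closed relative to `b`. -/
def TorsionFree (j : Nucleus A) (a b : A) : Prop :=
  ∀ x, a ≤ x → x ≤ b → j x ⊓ b ≤ x

theorem TorsionFree.mono {j : Nucleus A} {a b c d : A} (h : TorsionFree j a b)
    (hac : a ≤ c) (hdb : d ≤ b) : TorsionFree j c d := fun x hcx hxd =>
  (inf_le_inf_left _ hdb).trans (h x (hac.trans hcx) (hxd.trans hdb))

theorem torsionFree_refl (j : Nucleus A) (a : A) : TorsionFree j a a :=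
  fun _ h _ => inf_le_right.trans h

theorem torsionFree_of_inf_le {j k : Nucleus A} (h : ∀ x, k x ⊓ j x ≤ x) {a b : A}
    (hb : b ≤ k a) : TorsionFree j a b := fun x hax _ =>
  (le_inf (inf_le_right.trans (hb.trans (k.monotone hax))) inf_le_left).trans (h x)

section Modular
variable [IsModularLattice A]

/-- By modularity it suffices to compare `x` and its relative closure after meeting and joining with
`r`: the joins agree because `l ≤ x`, the meets by torsion-freeness below. -/
theorem TorsionFree.sup {j : Nucleus A} {l r : A} (h : TorsionFree j (l ⊓ r) r) :
    TorsionFree j l (l ⊔ r) := by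
  intro x hlx hxr
  refine (eq_of_le_of_inf_le_of_sup_le (z := r) (le_inf j.le_apply hxr) ?_ ?_).ge
  · refine le_inf ?_ inf_le_right
    refine le_trans ?_ ((h (x ⊓ r) (inf_le_inf_right r hlx) inf_le_right).trans inf_le_left)
    rw [j.map_inf]
    exact le_inf (le_inf (inf_le_left.trans inf_le_left) (inf_le_right.trans j.le_apply))
      inf_le_right
  · exact (sup_le inf_le_right le_sup_right).trans (sup_le_sup_right hlx r)

theorem TorsionFree.inf {j : Nucleus A} {l r : A} (h : TorsionFree j l (l ⊔ r)) :
    TorsionFree j (l ⊓ r) r := by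
  intro x hlx hxr
  refine (eq_of_le_of_inf_le_of_sup_le (z := l) (le_inf j.le_apply hxr) ?_ ?_).ge
  · refine le_inf ?_ inf_le_right
    exact (le_inf inf_le_right (inf_le_left.trans inf_le_right)).trans hlx
  · refine sup_le ?_ le_sup_right
    refine le_trans (le_inf ?_ ?_) (h (x ⊔ l) le_sup_right (sup_le (hxr.trans le_sup_right)
      le_sup_left))
    · exact inf_le_left.trans (j.monotone le_sup_left)
    · exact inf_le_right.trans le_sup_right

theorem TorsionFree.trans {j : Nucleus A} {a b c : A} (hab : a ≤ b) (hbc : b ≤ c)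
    (h₁ : TorsionFree j a b) (h₂ : TorsionFree j b c) : TorsionFree j a c := by
  intro x hax hxc
  refine (eq_of_le_of_inf_le_of_sup_le (z := b) (le_inf j.le_apply hxc) ?_ ?_).ge
  · refine le_inf ?_ inf_le_right
    refine le_trans ?_ ((h₁ (x ⊓ b) (le_inf hax hab) inf_le_right).trans inf_le_left)
    rw [j.map_inf]
    exact le_inf (le_inf (inf_le_left.trans inf_le_left) (inf_le_right.trans j.le_apply))
      inf_le_right
  · refine sup_le ?_ le_sup_right
    exact (inf_le_inf_right c (j.monotone le_sup_left)).trans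
      (h₂ (x ⊔ b) le_sup_right (sup_le hxc hbc))

theorem TorsionFree.sup_of_common_bot {j : Nucleus A} {a b c : A} (hab : a ≤ b) (hac : a ≤ c)
    (h₁ : TorsionFree j a b) (h₂ : TorsionFree j a c) : TorsionFree j a (b ⊔ c) :=
  h₁.trans hab le_sup_left (h₂.mono (le_inf hab hac) le_rfl).sup

end Modular

/-- The largest element above `a` with torsion-free interval. -/
def torsionFreeSup (j : Nucleus A) (a : A) : A := sSup {b | a ≤ b ∧ TorsionFree j a b}

theorem le_torsionFreeSup (j : Nucleus A) (a : A) : a ≤ torsionFreeSup j a :=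
  le_sSup ⟨le_rfl, torsionFree_refl j a⟩

variable [IsIdiom A]

theorem torsionFree_sSup (j : Nucleus A) {a : A} {X : Set A} (hX : DirectedOn (· ≤ ·) X)
    (hle : ∀ x ∈ X, a ≤ x) (h : ∀ x ∈ X, TorsionFree j a x) : TorsionFree j a (sSup X) := by
  intro z haz _
  rw [IsIdiom.inf_sSup_of_directedOn _ _ hX]
  refine iSup₂_le fun x hx => ?_
  refine le_trans ?_ ((h x hx (z ⊓ x) (le_inf haz (hle x hx)) inf_le_right).trans inf_le_left)
  rw [j.map_inf]
  exact le_inf (le_inf inf_le_left (inf_le_right.trans j.le_apply)) inf_le_right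

theorem torsionFree_torsionFreeSup (j : Nucleus A) (a : A) :
    TorsionFree j a (torsionFreeSup j a) := by
  refine torsionFree_sSup j ?_ (fun _ h => h.1) (fun _ h => h.2)
  rintro b ⟨hab, hb⟩ c ⟨hac, hc⟩
  exact ⟨b ⊔ c, ⟨hab.trans le_sup_left, hb.sup_of_common_bot hab hac hc⟩, le_sup_left,
    le_sup_right⟩

theorem le_torsionFreeSup_iff (j : Nucleus A) {a b : A} (hab : a ≤ b) :
    b ≤ torsionFreeSup j a ↔ TorsionFree j a b :=
  ⟨fun h => (torsionFree_torsionFreeSup j a).mono le_rfl h, fun h => le_sSup ⟨hab, h⟩⟩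

theorem torsionFreeSup_mono (j : Nucleus A) : Monotone (torsionFreeSup j) := by
  intro a b hab
  refine le_sup_right.trans ((le_torsionFreeSup_iff j le_sup_left).2 ?_)
  exact ((torsionFree_torsionFreeSup j a).mono
    (le_inf hab (le_torsionFreeSup j a)) le_rfl).sup

/-- The pseudocomplement of `j`: the nucleus whose torsion intervals are the intervals that are
torsion-free for `j`. -/
def torsionFreeNucleus (j : Nucleus A) : Nucleus A where
  toFun := torsionFreeSup j
  map_inf' a b := by
    refine le_antisymm ((torsionFreeSup_mono j).map_inf_le a b) ?_
    set p := torsionFreeSup j a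
    set q := torsionFreeSup j b
    have ha : a ≤ p := le_torsionFreeSup j a
    have hb : b ≤ q := le_torsionFreeSup j b
    refine (le_torsionFreeSup_iff j (inf_le_inf ha hb)).2 ?_
    -- Climb `a ⊓ b ≤ p ⊓ b ≤ p ⊓ q`: each step is similar to a subinterval of `[a, p]` or `[b, q]`.
    have h₁ : TorsionFree j (a ⊓ (p ⊓ b)) (p ⊓ b) :=
      ((torsionFree_torsionFreeSup j a).mono le_rfl (sup_le ha inf_le_left)).inf
    have h₂ : TorsionFree j (b ⊓ (p ⊓ q)) (p ⊓ q) :=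
      ((torsionFree_torsionFreeSup j b).mono le_rfl (sup_le hb inf_le_right)).inf
    refine TorsionFree.trans (b := p ⊓ b) (inf_le_inf_right b ha) (inf_le_inf_left p hb)
      (h₁.mono ?_ le_rfl) (h₂.mono ?_ le_rfl)
    · exact le_inf inf_le_left (inf_le_right.trans inf_le_right)
    · exact le_inf (inf_le_right.trans inf_le_left) inf_le_left
  idempotent' a := (le_torsionFreeSup_iff j
      ((le_torsionFreeSup j a).trans (le_torsionFreeSup j _))).2
    ((torsionFree_torsionFreeSup j a).trans (le_torsionFreeSup j a)
      (le_torsionFreeSup j _) (torsionFree_torsionFreeSup j _))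
  le_apply' := le_torsionFreeSup j

theorem torsionFreeNucleus_inf_le (j : Nucleus A) (a : A) :
    torsionFreeNucleus j a ⊓ j a ≤ a := by
  rw [inf_comm]
  exact torsionFree_torsionFreeSup j a a le_rfl (le_torsionFreeSup j a)

theorem le_torsionFreeNucleus {j k : Nucleus A} (h : ∀ x, k x ⊓ j x ≤ x) (a : A) :
    k a ≤ torsionFreeNucleus j a :=
  (le_torsionFreeSup_iff j k.le_apply).2 (torsionFree_of_inf_le h le_rfl)

/-- The supremum `neg j` stays below `torsionFreeNucleus j`, which bounds every nucleus meeting `j`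
trivially and itself meets `j` trivially. -/
theorem neg_inf_le (j : Nucleus A) (a : A) : neg j a ⊓ j a ≤ a := by
  have h : neg j ≤ torsionFreeNucleus j := sSup_le fun k hk x =>
    le_torsionFreeNucleus (fun y => (DFunLike.congr_fun hk y).le) x
  exact (inf_le_inf_right _ (h a)).trans (torsionFreeNucleus_inf_le j a)

end TorsionFree

/-! ### Complements in the quotient of a spectral nucleus -/

section Spectral
variable {A : Type u} [CompleteLattice A]

theorem IsSpectral.exists_isCompl {j : Nucleus A} (hj : IsSpectral j) {x : A} (hx : j x = x) :
    ∃ z, j z = z ∧ x ⊓ z ≤ j ⊥ ∧ j (x ⊔ z) = ⊤ := by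
  obtain ⟨⟨z, hz⟩, hd, hc⟩ :=
    ComplementedLattice.exists_isCompl (self := hj) (⟨x, hx⟩ : FixedPts j)
  refine ⟨z, hz, ?_, ?_⟩
  · have h₁ : j (x ⊓ z) ≤ (⊥ : FixedPts j).1 :=
      hd (x := (⟨j (x ⊓ z), j.idempotent _⟩ : FixedPts j))
        ((j.monotone inf_le_left).trans hx.le : j (x ⊓ z) ≤ x)
        ((j.monotone inf_le_right).trans hz.le : j (x ⊓ z) ≤ z)
    have h₂ : (⊥ : FixedPts j).1 ≤ j ⊥ :=
      (inferInstance : CompleteLattice (FixedPts j)).bot_le ⟨j ⊥, j.idempotent _⟩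
    exact j.le_apply.trans (h₁.trans h₂)
  · have h₁ : (⊤ : FixedPts j).1 ≤ j (x ⊔ z) :=
      hc (x := (⟨j (x ⊔ z), j.idempotent _⟩ : FixedPts j))
        (le_sup_left.trans j.le_apply : x ≤ j (x ⊔ z))
        (le_sup_right.trans j.le_apply : z ≤ j (x ⊔ z))
    have h₂ : ⊤ ≤ (⊤ : FixedPts j).1 :=
      (inferInstance : CompleteLattice (FixedPts j)).le_top ⟨⊤, map_top j⟩
    exact top_le_iff.1 (h₂.trans h₁)

variable [IsModularLattice A]

/-- Relative complements in the quotient of a spectral nucleus. -/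
theorem IsSpectral.exists_relative_compl {j : Nucleus A} (hj : IsSpectral j) {p x q : A}
    (hp : j p = p) (hx : j x = x) (hq : j q = q) (hpx : p ≤ x) (hxq : x ≤ q) :
    ∃ z, j z = z ∧ p ≤ z ∧ z ≤ q ∧ x ⊓ z ≤ p ∧ q ≤ j (x ⊔ z) := by
  obtain ⟨z, hz, hinf, hsup⟩ := hj.exists_isCompl hx
  refine ⟨j (z ⊔ p) ⊓ q, ?_, ?_, inf_le_right, ?_, ?_⟩
  · rw [j.map_inf, j.idempotent, hq]
  · exact le_inf (le_sup_right.trans j.le_apply) (hpx.trans hxq)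
  · calc x ⊓ (j (z ⊔ p) ⊓ q) ≤ j x ⊓ j (z ⊔ p) := by
          rw [hx]; exact inf_le_inf_left _ inf_le_left
      _ = j (x ⊓ z ⊔ p) := by rw [← j.map_inf, ← inf_sup_assoc_of_le z hpx]
      _ ≤ j p := (j.monotone (sup_le (hinf.trans (j.monotone bot_le)) j.le_apply)).trans_eq
          (j.idempotent p)
      _ = p := hp
  · calc q = j ((x ⊔ z) ⊓ q) := by rw [j.map_inf, hsup, hq, top_inf_eq]
      _ = j (x ⊔ z ⊓ q) := by rw [sup_inf_assoc_of_le z hxq]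
      _ ≤ j (x ⊔ j (z ⊔ p) ⊓ q) := j.monotone
          (sup_le_sup_left (inf_le_inf_right q (le_sup_left.trans j.le_apply)) x)

/-- A covering that survives in the quotient of a spectral nucleus is projected down to the bottom
of a torsion-free interval. -/
theorem IsSpectral.exists_covBy {j : Nucleus A} (hj : IsSpectral j) {b c x y : A}
    (hc : j c ⊓ b ≤ c) (hcx : c ≤ x) (hxy : x ⋖ y) (hyb : y ≤ b) (hx : j x ⊓ y ≤ x) :
    ∃ w, c ⋖ w ∧ w ≤ b := by
  obtain ⟨z, hz, hpz, hzq, hinf, hsup⟩ := hj.exists_relative_compl (j.idempotent c)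
    (j.idempotent x) (j.idempotent y) (j.monotone hcx) (j.monotone hxy.le)
  have hw : x ⊓ (y ⊓ z) = c := by
    refine le_antisymm ?_ (le_inf hcx (le_inf (hcx.trans hxy.le) (j.le_apply.trans hpz)))
    refine (le_inf ?_ (inf_le_right.trans (inf_le_left.trans hyb))).trans hc
    exact (inf_le_inf j.le_apply inf_le_right).trans hinf
  refine ⟨y ⊓ z, ?_, inf_le_left.trans hyb⟩
  have hnle : ¬ y ⊓ z ≤ x := by
    intro hle
    have hzc : z ≤ j c := by
      rw [← hw, inf_eq_right.2 hle, j.map_inf, hz]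
      exact le_inf hzq le_rfl
    have hyx : y ≤ j x := j.le_apply.trans <| hsup.trans <| by
      rw [sup_eq_left.2 (hzc.trans (j.monotone hcx)), j.idempotent]
    exact hxy.lt.not_ge ((le_inf hyx le_rfl).trans hx)
  have hsup' : x ⊔ y ⊓ z = y := by
    rcases hxy.eq_or_eq le_sup_left (sup_le hxy.le inf_le_left) with h | h
    · exact absurd (sup_eq_left.1 h) hnle
    · exact h
  -- `x ⋖ x ⊔ (y ⊓ z)`, so modularity makes `y ⊓ z` cover `x ⊓ (y ⊓ z) = c`.
  rw [← hw]
  exact inf_covBy_of_covBy_sup_left (by rwa [hsup'])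

end Spectral

/-! ### Atoms in weakly atomic intervals; semi-atomicity -/

section WeaklyAtomic
variable {A : Type u} [CompleteLattice A]

theorem itv_mem_Smp_iff {x y : A} (h : x < y) : itv x y h.le ∈ Smp ↔ x ⋖ y :=
  ⟨fun hs => ⟨h, fun z hxz hzy => hs ⟨z, hxz, hzy⟩⟩, fun hc ⟨_, hxz, hzy⟩ => hc.2 hxz hzy⟩

theorem itv_mem_WA_iff {a b : A} (h : a ≤ b) : itv a b h ∈ WA ↔
    ∀ c d, a ≤ c → c < d → d ≤ b → ∃ x y : A, c ≤ x ∧ y ≤ d ∧ x ⋖ y := by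
  constructor
  · intro hw c d hac hcd hdb
    obtain ⟨x, y, hxy, hcx, hyd, hs⟩ := hw c d hac hcd hdb
    exact ⟨x, y, hcx, hyd, (itv_mem_Smp_iff hxy).1 hs⟩
  · intro hw c d hac hcd hdb
    obtain ⟨x, y, hcx, hyd, hs⟩ := hw c d hac hcd hdb
    exact ⟨x, y, hs.lt, hcx, hyd, (itv_mem_Smp_iff hs.lt).2 hs⟩

/-- If two spectral nuclei have trivial meet, then every nontrivial weakly atomic interval has an
atom. -/
theorem exists_covBy_of_mem_WA [IsModularLattice A] {j k : Nucleus A} (hj : IsSpectral j)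
    (hk : IsSpectral k) (h : ∀ x, k x ⊓ j x ≤ x) {c b : A} (hcb : c < b)
    (hw : itv c b hcb.le ∈ WA) : ∃ w, c ⋖ w ∧ w ≤ b := by
  rw [itv_mem_WA_iff] at hw
  have torsion : ∀ {j k : Nucleus A}, IsSpectral j → (∀ x, k x ⊓ j x ≤ x) → ¬ k c ⊓ b ≤ c →
      ∃ w, c ⋖ w ∧ w ≤ b := by
    intro j k hj h hc
    have hlt : c < k c ⊓ b := lt_of_le_not_ge (le_inf k.le_apply hcb.le) hc
    obtain ⟨x, y, hcx, hy, hxy⟩ := hw c (k c ⊓ b) le_rfl hlt inf_le_right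
    have hy' : y ≤ k c := hy.trans inf_le_left
    obtain ⟨w, hcw, hwb⟩ := hj.exists_covBy (torsionFree_of_inf_le h inf_le_left c le_rfl hlt.le)
      hcx hxy hy (torsionFree_of_inf_le h (hy'.trans (k.monotone hcx)) x le_rfl hxy.le)
    exact ⟨w, hcw, hwb.trans inf_le_right⟩
  by_cases hkc : k c ⊓ b ≤ c
  · by_cases hjc : j c ⊓ b ≤ c
    · obtain ⟨x, y, hcx, hyb, hxy⟩ := hw c b le_rfl hcb le_rfl
      -- A simple interval is either `j`-torsion-free or `j`-torsion; in the latter case it is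
      -- `k`-torsion-free.
      by_cases hjx : j x ⊓ y ≤ x
      · exact hj.exists_covBy hjc hcx hxy hyb hjx
      · refine hk.exists_covBy hkc hcx hxy hyb ?_
        have hyj : y ≤ j x := by
          rcases hxy.eq_or_eq (le_inf j.le_apply hxy.le) inf_le_right with e | e
          · exact absurd e.le hjx
          · exact inf_eq_right.1 e
        exact (inf_le_inf_left _ hyj).trans (h x)
    · exact torsion hk (fun x => (inf_comm _ _).trans_le (h x)) hjc
  · exact torsion hj h hkc

theorem Smp_subset_SSp : (Smp : Set (NonemptyInterval A)) ⊆ SSp := by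
  rintro ⟨⟨a, b⟩, hab⟩ hs
  exact ⟨{b}, by simpa using hab, by rintro x rfl; exact ⟨hab, hs⟩, by simpa using hab⟩

theorem itv_self_mem_Smp (a : A) : itv a a le_rfl ∈ Smp := fun ⟨_, h₁, h₂⟩ =>
  (h₁.trans h₂).false

theorem IsDivisionSet.SSp_subset {D : Set (NonemptyInterval A)} (hD : IsDivisionSet D)
    (hS : Smp ⊆ D) : SSp ⊆ D := by
  rintro ⟨⟨a, b⟩, hab⟩ ⟨X, hX, hs, hb : a ⊔ sSup X = b⟩
  -- Adjoining `a` covers the case of empty `X`.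
  have key := hD.2.sup a (insert a X) (Set.insert_nonempty _ _)
    (by
      rintro x (rfl | hx)
      exacts [le_rfl, (hX hx).1])
    (by
      rintro x (rfl | hx)
      exacts [hS (itv_self_mem_Smp x), hS (hs x hx).2])
  simp only [sSup_insert, hb] at key
  exact key

theorem SA_subset_Dvs {B : Set (NonemptyInterval A)} (h : Smp ⊆ B) : SA ⊆ Dvs B :=
  fun _ hI D hD => hI D ⟨hD.1, hD.1.SSp_subset (h.trans hD.2)⟩

/-- For the identity nucleus the division set consists of trivial intervals, so criticality amounts
to simplicity. -/
theorem Smp_subset_Crt_bot :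
    (Smp : Set (NonemptyInterval A)) ⊆ Crt (divisionSet (⊥ : Nucleus A)) := by
  rintro ⟨⟨a, b⟩, hab⟩ hs x hax hxb
  rcases eq_or_lt_of_le hax with h | h
  · exact Or.inl h
  · refine Or.inr (show b ≤ x from not_lt_iff_le_imp_ge.1 (fun hlt => hs ⟨x, h, hlt⟩) hxb)

/-- In a division set containing the simple intervals there is a largest `x ≤ b` with `[a, x]` in
it; an atom over `x` below `b` would enlarge it. -/
theorem mem_SA_of_exists_covBy {a b : A} (hab : a ≤ b)
    (h : ∀ c, a ≤ c → c < b → ∃ w, c ⋖ w ∧ w ≤ b) : itv a b hab ∈ SA := by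
  rintro D ⟨hD, hS⟩
  have hS' := Smp_subset_SSp.trans hS
  let X := {x | ∃ h : a ≤ x, x ≤ b ∧ itv a x h ∈ D}
  have haX : a ∈ X := ⟨le_rfl, hab, hS' (itv_self_mem_Smp a)⟩
  have hc : itv a (sSup X) (le_sSup haX) ∈ D :=
    hD.2.sup a X ⟨a, haX⟩ (fun x hx => hx.1) (fun x hx => hx.2.2)
  have hcb : sSup X ≤ b := sSup_le fun x hx => hx.2.1
  rcases eq_or_lt_of_le hcb with e | hlt
  · simpa only [e] using hc
  · obtain ⟨w, hcw, hwb⟩ := h _ (le_sSup haX) hlt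
    have hw := hD.1.abut _ _ _ (le_sSup haX) hcw.le hc (hS' ((itv_mem_Smp_iff hcw.lt).2 hcw))
    exact absurd (le_sSup (show w ∈ X from ⟨_, hwb, hw⟩)) hcw.lt.not_ge

theorem WA_subset_SA [IsModularLattice A] {j k : Nucleus A} (hj : IsSpectral j)
    (hk : IsSpectral k) (h : ∀ x, k x ⊓ j x ≤ x) : (WA : Set (NonemptyInterval A)) ⊆ SA := by
  rintro ⟨⟨a, b⟩, hab⟩ hw
  exact mem_SA_of_exists_covBy hab fun c hac hcb => exists_covBy_of_mem_WA hj hk h hcb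
    fun x y hcx hxy hyb => hw x y (hac.trans hcx) hxy hyb

theorem assocInflator_eq_top {B : Set (NonemptyInterval A)} (h : B = Set.univ) :
    assocInflator B = fun _ => ⊤ :=
  funext fun _ => top_le_iff.1 (le_sSup ⟨le_top, h ▸ Set.mem_univ _⟩)

end WeaklyAtomic

/-! ### Ordinal iterates of the socle -/

section Iteration
variable {A : Type u} [CompleteLattice A]

theorem iter_add_one (d : A → A) (α : Ordinal.{u}) : iter d (α + 1) = d ∘ iter d α :=
  Ordinal.limitRecOn_add_one ..

theorem iter_limit (d : A → A) {α : Ordinal.{u}} (h : Order.IsSuccLimit α) (a : A) :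
    iter d α a = ⨆ β : Set.Iio α, iter d β.1 a := by
  unfold iter
  rw [Ordinal.limitRecOn_limit _ _ _ _ h]

theorem iter_mono {d : A → A} (hd : ∀ a, a ≤ d a) : Monotone (iter d) := by
  have key : ∀ β α : Ordinal.{u}, α ≤ β → iter d α ≤ iter d β := by
    intro β
    induction β using Ordinal.limitRecOn with
    | zero => intro α h; rw [nonpos_iff_eq_zero.1 h]
    | add_one β ih =>
      intro α h
      rcases eq_or_lt_of_le h with rfl | h
      · exact le_rfl
      · rw [iter_add_one]
        exact (ih α (Order.lt_add_one_iff.1 h)).trans fun _ => hd _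
    | limit β hβ ih =>
      intro α h
      rcases eq_or_lt_of_le h with rfl | h
      · exact le_rfl
      · intro a
        rw [iter_limit d hβ]
        exact le_iSup (fun γ : Set.Iio β => iter d γ.1 a) ⟨α, h⟩
  exact fun α β h => key β α h

theorem iterInfty_eq_top {d : A → A} (hd : ∀ a, a ≤ d a) (hfix : ∀ a, d a ≤ a → a = ⊤) :
    iterInfty d = fun _ => ⊤ := by
  have htop : ∀ α, iter d (α + 1) ≤ iter d α → iter d α = fun _ => ⊤ := fun α h =>
    funext fun a => hfix _ (iter_add_one d α ▸ h a : (d ∘ iter d α) a ≤ _)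
  -- Two stages coincide for reasons of size; by monotonicity the iterates are then stationary at
  -- the smaller one.
  obtain ⟨α, β, heq, hne⟩ := Function.not_injective_iff.1 (not_injective_of_ordinal (iter d))
  obtain ⟨γ, hγ⟩ : ∃ γ, iter d (γ + 1) ≤ iter d γ := by
    rcases lt_or_gt_of_ne hne with h | h
    · exact ⟨α, (iter_mono hd (Order.add_one_le_of_lt h)).trans heq.ge⟩
    · exact ⟨β, (iter_mono hd (Order.add_one_le_of_lt h)).trans heq.le⟩
  have hne' : {γ : Ordinal.{u} | ∀ α, γ ≤ α → iter d α = iter d γ}.Nonempty := by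
    refine ⟨γ, fun α hα => le_antisymm ?_ (iter_mono hd hα)⟩
    rw [htop γ hγ]
    exact fun _ => le_top
  have hmem := csInf_mem hne'
  exact htop _ (hmem _ (Order.le_succ _)).le

theorem le_soc (a : A) : a ≤ soc a := le_sSup ⟨le_rfl, itv_self_mem_Smp a⟩

theorem le_soc_of_covBy {a b : A} (h : a ⋖ b) : b ≤ soc a :=
  le_sSup ⟨h.le, (itv_mem_Smp_iff h.lt).2 h⟩

end Iteration

/-! ### Linear nuclei and semiartinian rings -/

section Rings
variable {R : Type u} [Ring R]

instance isIdiom_ideal : IsIdiom (Ideal R) where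
  inf_sSup_of_directedOn _ _ h := h.inf_sSup_eq

theorem mem_colon {I : Ideal R} {r s : R} : s ∈ colon I r ↔ s * r ∈ I := Iff.rfl

theorem colon_mono {I J : Ideal R} (h : I ≤ J) (r : R) : colon I r ≤ colon J r :=
  fun _ hs => h hs

/-- The left ideal `K r + I`. -/
def mulAdd (K : Ideal R) (r : R) (I : Ideal R) : Ideal R :=
  Submodule.map (LinearMap.toSpanSingleton R R r) K ⊔ I

theorem mem_mulAdd {K I : Ideal R} {r s : R} :
    s ∈ mulAdd K r I ↔ ∃ k ∈ K, ∃ i ∈ I, k * r + i = s := by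
  simp [mulAdd, Submodule.mem_sup]

theorem mulAdd_le_iff {K I J : Ideal R} {r : R} :
    mulAdd K r I ≤ J ↔ K ≤ colon J r ∧ I ≤ J := by
  rw [mulAdd, sup_le_iff, Submodule.map_le_iff_le_comap, colon]

theorem colon_mulAdd {K I : Ideal R} {r : R} (h : colon I r ≤ K) :
    colon (mulAdd K r I) r = K := by
  refine le_antisymm (fun s hs => ?_) (mulAdd_le_iff.1 le_rfl).1
  obtain ⟨k, hk, i, hi, e⟩ := mem_mulAdd.1 (mem_colon.1 hs)
  have : s - k ∈ colon I r := by
    rw [mem_colon, sub_mul, ← e, add_sub_cancel_left]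
    exact hi
  simpa using K.add_mem (h this) hk

/-- Right multiplication by `r` identifies `K / (I : r)` with `(K r + I) / I`; as `j` is linear,
torsion-freeness transfers both ways. -/
theorem isLinearNucleus_torsionFreeNucleus {j : Nucleus (Ideal R)} (hj : IsLinearNucleus j) :
    IsLinearNucleus (torsionFreeNucleus j) := by
  intro I r
  refine le_antisymm ?_ ?_
  · set K := torsionFreeNucleus j (colon I r)
    have hK : colon I r ≤ K := Nucleus.le_apply
    suffices h : mulAdd K r I ≤ torsionFreeNucleus j I from (mulAdd_le_iff.1 h).1
    refine (le_torsionFreeSup_iff j (mulAdd_le_iff.1 le_rfl).2).2 ?_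
    rintro Y hIY hY s ⟨hsj, hs⟩
    obtain ⟨k, hk, i, hi, rfl⟩ := mem_mulAdd.1 hs
    have hkj : k ∈ j (colon Y r) := by
      rw [hj, mem_colon]
      simpa using (j Y).sub_mem hsj (j.le_apply (hIY hi))
    have hYK : colon Y r ≤ K := (colon_mono hY r).trans (colon_mulAdd hK).le
    exact Y.add_mem (torsionFree_torsionFreeSup j (colon I r) (colon Y r) (colon_mono hIY r) hYK
      ⟨hkj, hk⟩) (hIY hi)
  · refine (le_torsionFreeSup_iff j (colon_mono Nucleus.le_apply r)).2 ?_
    rintro X hIX hX s ⟨hsj, hs⟩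
    rw [← colon_mulAdd hIX, hj] at hsj
    rw [← colon_mulAdd hIX]
    exact torsionFree_torsionFreeSup j I (mulAdd X r I) (mulAdd_le_iff.1 le_rfl).2
      (mulAdd_le_iff.2 ⟨hX, le_torsionFreeSup j I⟩) ⟨hsj, hs⟩

/-- The pointwise meet and the identity are themselves linear, so a trivial meet among linear nuclei
is trivial pointwise. -/
theorem LinearNucleus.inf_le {j k : LinearNucleus R} (h : k ⊓ j = ⊥) (I : Ideal R) :
    k.1 I ⊓ j.1 I ≤ I := by
  let p : LinearNucleus R := ⟨k.1 ⊓ j.1, fun I r => by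
    rw [Nucleus.inf_apply, Nucleus.inf_apply, k.2, j.2]
    rfl⟩
  have hp : p ≤ k ⊓ j := le_inf (show k.1 ⊓ j.1 ≤ k.1 from inf_le_left)
    (show k.1 ⊓ j.1 ≤ j.1 from inf_le_right)
  rw [h] at hp
  have hbot : p ≤ (⟨⊥, fun _ _ => rfl⟩ : LinearNucleus R) := hp.trans bot_le
  exact (show k.1 ⊓ j.1 ≤ ⊥ from hbot) I

theorem LinearNucleus.neg_inf_le (j : LinearNucleus R) (I : Ideal R) :
    (neg j).1 I ⊓ j.1 I ≤ I := by
  have h : neg j ≤ ⟨_, isLinearNucleus_torsionFreeNucleus j.2⟩ := sSup_le fun k hk =>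
    show k.1 ≤ torsionFreeNucleus j.1 from le_torsionFreeNucleus (LinearNucleus.inf_le hk)
  exact (inf_le_inf_right _ ((show (neg j).1 ≤ torsionFreeNucleus j.1 from h) I)).trans
    (torsionFreeNucleus_inf_le j.1 I)

theorem exists_covBy_of_lt_ideal {I J : Ideal R} (h : I < J) :
    ∃ X Y : Ideal R, I ≤ X ∧ Y ≤ J ∧ X ⋖ Y := by
  obtain ⟨hIJ, x, hxJ, hxI⟩ := SetLike.lt_iff_le_and_exists.1 h
  have hchain : ∀ c ⊆ {K : Ideal R | K ≤ I ⊔ Ideal.span {x} ∧ x ∉ K}, IsChain (· ≤ ·) c →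
      ∀ y ∈ c, ∃ ub ∈ {K : Ideal R | K ≤ I ⊔ Ideal.span {x} ∧ x ∉ K}, ∀ z ∈ c, z ≤ ub := by
    refine fun c hc hch y hy => ⟨sSup c, ⟨sSup_le fun z hz => (hc hz).1, fun hx => ?_⟩,
      fun z hz => le_sSup hz⟩
    obtain ⟨z, hz, hxz⟩ := (Submodule.mem_sSup_of_directed ⟨y, hy⟩ hch.directedOn).1 hx
    exact (hc hz).2 hxz
  -- A left ideal `X` maximal among those inside `I + R x` that avoid `x` is covered by `I + R x`.
  obtain ⟨X, hIX, hX⟩ := zorn_le_nonempty₀ _ hchain I ⟨le_sup_left, hxI⟩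
  have hxY : x ∈ I ⊔ Ideal.span {x} :=
    (le_sup_right : Ideal.span {x} ≤ _) (Ideal.mem_span_singleton_self x)
  refine ⟨X, I ⊔ Ideal.span {x}, hIX, sup_le hIJ ((Ideal.span_singleton_le_iff_mem J).2 hxJ),
    lt_of_le_of_ne hX.1.1 fun e => hX.1.2 (e ▸ hxY), fun Z hXZ hZ => ?_⟩
  by_cases hxZ : x ∈ Z
  · exact hZ.not_ge (sup_le (hIX.trans hXZ.le) ((Ideal.span_singleton_le_iff_mem Z).2 hxZ))
  · exact hXZ.not_ge (hX.2 ⟨hZ.le, hxZ⟩ hXZ.le)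

theorem itv_mem_WA_ideal {I J : Ideal R} (h : I ≤ J) : itv I J h ∈ WA := by
  rw [itv_mem_WA_iff]
  exact fun _ _ _ hlt _ => exists_covBy_of_lt_ideal hlt

/-- For `m ≠ 0`, `R m ≅ R / ann m`; a cover of `ann m` maps onto a simple submodule of `R m`. -/
theorem isLeftSemiartinian_of_exists_covBy
    (h : ∀ I : Ideal R, I < ⊤ → ∃ J, I ⋖ J) : IsLeftSemiartinian.{u, w} R := by
  intro M _ _ hM
  obtain ⟨m, hm⟩ := exists_ne (0 : M)
  set f := LinearMap.toSpanSingleton R M m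
  have hlt : LinearMap.ker f < ⊤ := by
    refine lt_top_iff_ne_top.2 fun e => hm ?_
    have : (1 : R) ∈ LinearMap.ker f := e ▸ Submodule.mem_top
    simpa [f] using this
  obtain ⟨J, hJ⟩ := h _ hlt
  have hcomap : Submodule.comap f (Submodule.map f J) = J := by
    rw [Submodule.comap_map_eq, sup_eq_left.2 hJ.le]
  refine ⟨Submodule.map f J, isSimpleModule_iff_isAtom.2 ⟨fun e => ?_, fun K hK => ?_⟩⟩
  · exact hJ.lt.not_ge (LinearMap.le_ker_iff_map.2 e)
  · have hKmap : Submodule.map f (Submodule.comap f K) = K := by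
      rw [Submodule.map_comap_eq]
      exact inf_eq_right.2 (hK.le.trans LinearMap.map_le_range)
    rcases hJ.eq_or_eq (LinearMap.ker_le_comap f)
      ((Submodule.comap_mono hK.le).trans hcomap.le) with e | e
    · rw [← hKmap, e, ← LinearMap.le_ker_iff_map]
    · exact absurd (e ▸ hKmap) hK.ne'

end Rings

end Idiom

open Idiom in
theorem mainTheorem12 :
    -- idioms
    (∀ (A : Type u) [CompleteLattice A] [IsIdiom A] (j : Nucleus A),
      IsSpectral j → IsSpectral (neg j) →
        (divisionSet (neg j) ∩ WA ⊆ SA ∧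
          divisionSet (neg (neg j)) ∩ WA ⊆ SA ∧
          (WA : Set (NonemptyInterval A)) ⊆ SA) ∧
        ((WA : Set (NonemptyInterval A)) = Set.univ →
          (SA : Set (NonemptyInterval A)) = Set.univ ∧
          Gab (⊥ : Nucleus A) = (fun _ => ⊤) ∧
          iterInfty (soc : A → A) = (fun _ => ⊤))) ∧
    -- rings
    (∀ (R : Type v) [Ring R] (j : LinearNucleus R),
      IsSpectral j.1 → IsSpectral (neg j).1 → IsLeftSemiartinian.{v, w} R) := by
  refine ⟨fun A _ _ j hj hk => ?_, fun R _ j hj hk => ?_⟩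
  · have hWS : (WA : Set (NonemptyInterval A)) ⊆ SA := WA_subset_SA hj hk (neg_inf_le j)
    refine ⟨⟨Set.inter_subset_right.trans hWS, Set.inter_subset_right.trans hWS, hWS⟩,
      fun hW => ?_⟩
    have hS : (SA : Set (NonemptyInterval A)) = Set.univ := Set.univ_subset_iff.1 (hW ▸ hWS)
    refine ⟨hS, assocInflator_eq_top (Set.univ_subset_iff.1
      (hS ▸ SA_subset_Dvs Smp_subset_Crt_bot)), iterInfty_eq_top le_soc fun a ha => ?_⟩
    by_contra hne
    obtain ⟨w, haw, -⟩ := exists_covBy_of_mem_WA hj hk (neg_inf_le j) (lt_top_iff_ne_top.2 hne)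
      (hW ▸ Set.mem_univ _)
    exact haw.lt.not_ge ((le_soc_of_covBy haw).trans ha)
  · refine isLeftSemiartinian_of_exists_covBy fun I hI => ?_
    obtain ⟨J, hIJ, -⟩ := exists_covBy_of_mem_WA hj hk (LinearNucleus.neg_inf_le j) hI
      (itv_mem_WA_ideal le_top)
    exact ⟨J, hIJ⟩
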